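/- **Perturbed cone theorem.** A connected open set $R\subseteq\mathbb{R}^n$ has the *enclosing property* if for every $p\in R$ there is an affine hyperplane $H\subset\mathbb{R}^n$ with $p\notin H$ such that the connected component $B$ of $R\setminus H$ containing $p$ is precompact, i.e. $\overline{B}$ is compact. A *perturbed cone* is a closed, path-connected set $C\subset\mathbb{R}^n$ such that $\mathbb{R}^n\setminus C$ has at least two connected components and at least one connected component of $\mathbb{R}^n\setminus C$ has the enclosing property; every connected component of $\mathbb{R}^n\setminus C$ with the enclosing property is called a *cone region* of $C$. A map $f\colon M\to\mathbb{R}^n$ from a Riemannian manifold $(M,g)$ is *harmonic* if it is smooth and its tension field $\operatorname{tr}_g\nabla df$ vanishes, that is, if in all local coordinates of $M$ $$\sum_{i,j} g^{ij}\Big(\partial_i\partial_j f-\sum_k\Gamma^k_{ij}\,\partial_k f\Big)=0,$$ where $\Gamma^k_{ij}$ are the Christoffel symbols of $g$; it is *proper* if preimages of compact subsets of $\mathbb{R}^n$ are compact. Let $C\subset\mathbb{R}^n$ be a perturbed cone, let $R$ be a cone region of $C$, and let $(M,g)$ be a complete connected Riemannian manifold (smooth, finite-dimensional, without boundary). Then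 every proper harmonic map $f\colon M\to\mathbb{R}^n$ with $f(M)\subseteq R$ is constant. -/

import Mathlib

open scoped Manifold ContDiff Bundle

noncomputable section

/-! ### Perturbed cones in Euclidean space -/

/-- An affine hyperplane of `ℝⁿ`: the solution set of one equation `⟪ν, x⟫ = c` with `ν ≠ 0`. -/
def IsAffineHyperplane {n : ℕ} (H : Set (EuclideanSpace ℝ (Fin n))) : Prop :=
  ∃ (ν : EuclideanSpace ℝ (Fin n)) (c : ℝ), ν ≠ 0 ∧ H = {x | inner ℝ ν x = c}

/-- The enclosing property: each `p ∈ R` lies off some affine hyperplane `H` for which the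
connected component of `R \ H` containing `p` is precompact. -/
def HasEnclosingProperty {n : ℕ} (R : Set (EuclideanSpace ℝ (Fin n))) : Prop :=
  ∀ p ∈ R, ∃ H : Set (EuclideanSpace ℝ (Fin n)), IsAffineHyperplane H ∧ p ∉ H ∧
    IsCompact (closure (connectedComponentIn (R \ H) p))

/-- `R` is one of the connected components of the set `U`. -/
def IsComponentOf {X : Type*} [TopologicalSpace X] (U R : Set X) : Prop :=
  ∃ x ∈ U, R = connectedComponentIn U x

/-- `R` is a cone region of `C`: a connected component of the complement of `C` which has the
enclosing property. -/
def IsConeRegion {n : ℕ} (C R : Set (EuclideanSpace ℝ (Fin n))) : Prop :=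
  IsComponentOf Cᶜ R ∧ HasEnclosingProperty R

/-- A perturbed cone: a closed path-connected set whose complement has at least two connected
components, one of which is a cone region. -/
structure IsPerturbedCone {n : ℕ} (C : Set (EuclideanSpace ℝ (Fin n))) : Prop where
  isClosed : IsClosed C
  isPathConnected : IsPathConnected C
  two_components : ∃ R₁ R₂, IsComponentOf Cᶜ R₁ ∧ IsComponentOf Cᶜ R₂ ∧ R₁ ≠ R₂
  exists_coneRegion : ∃ R, IsConeRegion C R

/-! ### Harmonic maps from a Riemannian manifold to Euclidean space

Everything is written in a chart `e` of an `m`-dimensional Riemannian manifold `M`, at a point `y`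
of the target of `e`, with coordinates `y₁, …, yₘ`. -/

/-- The partial derivative `∂ᵢ h` of a function `h` on `ℝᵐ` with values in a normed space. -/
def coordDeriv {m : ℕ} {V : Type*} [NormedAddCommGroup V] [NormedSpace ℝ V] (i : Fin m)
    (h : EuclideanSpace ℝ (Fin m) → V) (y : EuclideanSpace ℝ (Fin m)) : V :=
  fderiv ℝ h y (EuclideanSpace.single i 1)

section Chart

variable {m : ℕ} {M : Type*} [TopologicalSpace M] [ChartedSpace (EuclideanSpace ℝ (Fin m)) M]

/-- The coordinate vector field `∂/∂yᵢ` of the chart `e`, at the point `e.symm y` of `M`. -/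
def coordVector (e : OpenPartialHomeomorph M (EuclideanSpace ℝ (Fin m))) (i : Fin m)
    (y : EuclideanSpace ℝ (Fin m)) : TangentSpace (𝓡 m) (e.symm y) :=
  mfderiv (𝓡 m) (𝓡 m) e.symm y (EuclideanSpace.single i (1 : ℝ) : EuclideanSpace ℝ (Fin m))

variable [Bundle.RiemannianBundle (fun x : M => TangentSpace (𝓡 m) x)]

/-- The matrix `(gᵢⱼ)` of the Riemannian metric in the chart `e`. -/
def metricMatrix (e : OpenPartialHomeomorph M (EuclideanSpace ℝ (Fin m)))
    (y : EuclideanSpace ℝ (Fin m)) : Matrix (Fin m) (Fin m) ℝ :=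
  Matrix.of fun i j => inner ℝ (coordVector e i y) (coordVector e j y)

/-- The Christoffel symbol `Γᵏᵢⱼ = ½ ∑ₗ gᵏˡ (∂ᵢ gⱼₗ + ∂ⱼ gᵢₗ - ∂ₗ gᵢⱼ)` of the Levi-Civita
connection in the chart `e`. -/
def christoffel (e : OpenPartialHomeomorph M (EuclideanSpace ℝ (Fin m))) (k i j : Fin m)
    (y : EuclideanSpace ℝ (Fin m)) : ℝ :=
  (1 / 2 : ℝ) * ∑ l, (metricMatrix e y)⁻¹ k l *
    (coordDeriv i (fun z => metricMatrix e z j l) y + coordDeriv j (fun z => metricMatrix e z i l) y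
      - coordDeriv l (fun z => metricMatrix e z i j) y)

/-- The second fundamental form `(∇df)(∂ᵢ, ∂ⱼ) = ∂ᵢ∂ⱼ f - ∑ₖ Γᵏᵢⱼ ∂ₖ f` of a map `f` from `M` to the
flat space `ℝⁿ`, in the chart `e` (the Christoffel symbols of `ℝⁿ` vanish). -/
def secondFundamentalForm {n : ℕ} (e : OpenPartialHomeomorph M (EuclideanSpace ℝ (Fin m)))
    (f : M → EuclideanSpace ℝ (Fin n)) (i j : Fin m) (y : EuclideanSpace ℝ (Fin m)) :
    EuclideanSpace ℝ (Fin n) :=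
  coordDeriv i (coordDeriv j (f ∘ e.symm)) y
    - ∑ k, christoffel e k i j y • coordDeriv k (f ∘ e.symm) y

/-- The tension field `tr_g ∇df = ∑ᵢⱼ gⁱʲ (∇df)(∂ᵢ, ∂ⱼ)` of `f` in the chart `e`. -/
def tensionField {n : ℕ} (e : OpenPartialHomeomorph M (EuclideanSpace ℝ (Fin m)))
    (f : M → EuclideanSpace ℝ (Fin n)) (y : EuclideanSpace ℝ (Fin m)) :
    EuclideanSpace ℝ (Fin n) :=
  ∑ i, ∑ j, (metricMatrix e y)⁻¹ i j • secondFundamentalForm e f i j y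

/-- A map from a Riemannian manifold to `ℝⁿ` is harmonic if it is smooth and its tension field
vanishes, in all charts of the smooth structure. -/
def IsHarmonicMap {n : ℕ} (f : M → EuclideanSpace ℝ (Fin n)) : Prop :=
  ContMDiff (𝓡 m) (𝓡 n) ∞ f ∧
    ∀ e ∈ IsManifold.maximalAtlas (𝓡 m) ∞ M, ∀ y ∈ e.target, tensionField e f y = 0

end Chart

end

open Filter Topology Metric

noncomputable section

/-! ### Hopf's strong maximum principle on open subsets of `ℝᵐ`. -/

section EllipticMaximumPrinciple

variable {m : ℕ}

/-! Since the target is flat, every height function `⟪ν, f⟫` solves in each chart a linear elliptic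
equation with continuous coefficients and no zeroth-order term. By Hopf's strong maximum principle
it is constant near each of its local maxima (`IsHarmonicMap.eventually_inner_eq`).

The enclosing property forces `M` to be compact. Choose the hyperplane for a value `f x₀`, let `B`
be the precompact component and `ν` the normal pointing to the side of `f x₀`. Properness makes `K =
f ⁻¹' closure B` compact, so the height attains a maximum on `K`, strictly above the level of the
hyperplane. Inside `R`, the set `B` can only be left through the hyperplane, so points of `K` at
maximal height map into the open set `B` and are interior to `K`. The set of these points is
therefore clopen, hence equal to `M`, and `K = M`.

On a compact connected `M` every height function attains its maximum and is constant by the same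
clopen argument; as `ν` is arbitrary, `f` is constant. -/

lemma coordDeriv_coordDeriv {u : EuclideanSpace ℝ (Fin m) → ℝ} {y : EuclideanSpace ℝ (Fin m)}
    (hu : ContDiffAt ℝ 2 u y) (i j : Fin m) :
    coordDeriv i (coordDeriv j u) y
      = fderiv ℝ (fderiv ℝ u) y (EuclideanSpace.single i 1) (EuclideanSpace.single j 1) := by
  have hd : DifferentiableAt ℝ (fderiv ℝ u) y :=
    (hu.fderiv_right (m := 1) (by norm_num)).differentiableAt (by norm_num)
  change fderiv ℝ (fun z => fderiv ℝ u z (EuclideanSpace.single j 1)) y _ = _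
  rw [fderiv_clm_apply hd (by fun_prop)]
  simp

lemma ContDiffAt.coordDeriv {F : Type*} [NormedAddCommGroup F] [NormedSpace ℝ F]
    {u : EuclideanSpace ℝ (Fin m) → F} {y : EuclideanSpace ℝ (Fin m)} {k l : ℕ∞}
    (hu : ContDiffAt ℝ k u y) (hl : l + 1 ≤ k) (i : Fin m) :
    ContDiffAt ℝ l (_root_.coordDeriv i u) y :=
  (hu.fderiv_right (m := l) (by exact_mod_cast hl)).clm_apply contDiffAt_const

/-- The second order necessary condition at a local maximum. -/
lemma IsLocalMax.fderiv_fderiv_nonpos {E : Type*} [NormedAddCommGroup E] [NormedSpace ℝ E]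
    {u : E → ℝ} {y : E} (hmax : IsLocalMax u y) (hu : ContDiffAt ℝ 2 u y) (b : E) :
    fderiv ℝ (fderiv ℝ u) y b b ≤ 0 := by
  by_contra! hpos
  have hline : ∀ t : ℝ, HasDerivAt (fun t : ℝ => y + t • b) b t := fun t => by
    simpa using ((hasDerivAt_id t).smul_const b).const_add y
  have htend : Tendsto (fun t : ℝ => y + t • b) (𝓝 0) (𝓝 y) := by
    simpa using (hline 0).continuousAt.tendsto
  have hdu : ∀ᶠ z in 𝓝 y, DifferentiableAt ℝ u z :=
    (hu.eventually (by simp)).mono fun z hz => hz.differentiableAt (by norm_num)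
  have hderiv : deriv (fun t : ℝ => u (y + t • b)) =ᶠ[𝓝 0]
      fun t => fderiv ℝ u (y + t • b) b := by
    filter_upwards [htend.eventually hdu] with t ht
    exact (ht.hasFDerivAt.comp_hasDerivAt t (hline t)).deriv
  have hd : DifferentiableAt ℝ (fderiv ℝ u) y :=
    (hu.fderiv_right (m := 1) (by norm_num)).differentiableAt (by norm_num)
  have hdd : deriv (deriv (fun t : ℝ => u (y + t • b))) 0 = fderiv ℝ (fderiv ℝ u) y b b := by
    rw [hderiv.deriv_eq]
    have h1 : HasDerivAt (fun t : ℝ => fderiv ℝ u (y + t • b)) (fderiv ℝ (fderiv ℝ u) y b) 0 := by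
      have h0 : HasFDerivAt (fderiv ℝ u) (fderiv ℝ (fderiv ℝ u) y) (y + (0 : ℝ) • b) := by
        simpa using hd.hasFDerivAt
      exact h0.comp_hasDerivAt 0 (hline 0)
    simpa using (h1.clm_apply (hasDerivAt_const (0 : ℝ) b)).deriv
  have hmax' : IsLocalMax (fun t : ℝ => u (y + t • b)) 0 := by
    filter_upwards [htend.eventually hmax] with t ht
    simpa using ht
  have hcont : ContinuousAt (fun t : ℝ => u (y + t • b)) 0 := by
    have : ContinuousAt u (y + (0 : ℝ) • b) := by simpa using hu.continuousAt
    exact ContinuousAt.comp (f := fun t : ℝ => y + t • b) this (hline 0).continuousAt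
  -- A positive second derivative would make 0 a local minimum as well as a local maximum of the
  -- restriction to the line, which is then locally constant, so its second derivative is 0.
  have hmin := isLocalMin_of_deriv_deriv_pos (by rw [hdd]; exact hpos) hmax'.deriv_eq_zero hcont
  have hconst : (fun t : ℝ => u (y + t • b)) =ᶠ[𝓝 0] fun _ => u (y + (0 : ℝ) • b) := by
    filter_upwards [hmax', hmin] with t h1 h2
    exact le_antisymm h1 h2
  have h0 := hconst.deriv.deriv_eq
  rw [hdd] at h0
  simp at h0
  exact hpos.ne' h0

/-- A positive semidefinite matrix is a sum of rank-one matrices `v vᵀ`, and contracting `D` with `v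
vᵀ` gives `D v v`. -/
lemma Matrix.PosSemidef.sum_mul_apply_nonpos {A : Matrix (Fin m) (Fin m) ℝ} (hA : A.PosSemidef)
    {D : EuclideanSpace ℝ (Fin m) →L[ℝ] EuclideanSpace ℝ (Fin m) →L[ℝ] ℝ}
    (hD : ∀ b, D b b ≤ 0) :
    ∑ i, ∑ j, A i j * D (EuclideanSpace.single i 1) (EuclideanSpace.single j 1) ≤ 0 := by
  obtain ⟨k, v, rfl⟩ := Matrix.posSemidef_iff_eq_sum_vecMulVec.mp hA
  have key : ∀ b : Fin m → ℝ,
      ∑ i, ∑ j, b i * b j * D (EuclideanSpace.single i 1) (EuclideanSpace.single j 1)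
        = D (WithLp.toLp 2 b) (WithLp.toLp 2 b) := by
    intro b
    have hb : WithLp.toLp 2 b = ∑ i, b i • EuclideanSpace.single i (1 : ℝ) := by
      ext j
      simp [Finset.sum_apply, Pi.single_apply]
    rw [hb]
    simp only [map_sum, map_smul, _root_.sum_apply, _root_.smul_apply,
      smul_eq_mul, Finset.mul_sum]
    rw [Finset.sum_comm]
    refine Finset.sum_congr rfl fun i _ => Finset.sum_congr rfl fun j _ => ?_
    ring
  calc _ = ∑ l, D (WithLp.toLp 2 (v l)) (WithLp.toLp 2 (v l)) := by
        simp only [← key, Matrix.sum_apply, Matrix.vecMulVec_apply, Finset.sum_mul, star_trivial]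
        rw [Finset.sum_comm (s := (Finset.univ : Finset (Fin k)))]
        exact Finset.sum_congr rfl fun i _ => Finset.sum_comm
    _ ≤ 0 := Finset.sum_nonpos fun l _ => hD _

/-- The second order operator `∑ aᵢⱼ ∂ᵢ∂ⱼ + ∑ bₖ ∂ₖ` on functions on `ℝᵐ`. -/
def secondOrderOp (a : EuclideanSpace ℝ (Fin m) → Matrix (Fin m) (Fin m) ℝ)
    (b : EuclideanSpace ℝ (Fin m) → Fin m → ℝ) (u : EuclideanSpace ℝ (Fin m) → ℝ)
    (y : EuclideanSpace ℝ (Fin m)) : ℝ :=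
  ∑ i, ∑ j, a y i j * coordDeriv i (coordDeriv j u) y + ∑ k, b y k * coordDeriv k u y

variable {a : EuclideanSpace ℝ (Fin m) → Matrix (Fin m) (Fin m) ℝ}
  {b : EuclideanSpace ℝ (Fin m) → Fin m → ℝ} {u v : EuclideanSpace ℝ (Fin m) → ℝ}
  {y z w : EuclideanSpace ℝ (Fin m)}

lemma IsLocalMax.secondOrderOp_nonpos (hmax : IsLocalMax u y) (hu : ContDiffAt ℝ 2 u y)
    (ha : (a y).PosSemidef) : secondOrderOp a b u y ≤ 0 := by
  have h1 : ∀ k, coordDeriv k u y = 0 := fun k => by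
    simp [coordDeriv, hmax.fderiv_eq_zero]
  simp only [secondOrderOp, h1, coordDeriv_coordDeriv hu, mul_zero, Finset.sum_const_zero, add_zero]
  exact ha.sum_mul_apply_nonpos (hmax.fderiv_fderiv_nonpos hu)

lemma secondOrderOp_add_const_mul (hu : ContDiffAt ℝ 2 u y) (hv : ContDiffAt ℝ 2 v y) (ε : ℝ) :
    secondOrderOp a b (fun x => u x + ε * v x) y
      = secondOrderOp a b u y + ε * secondOrderOp a b v y := by
  have hd : ∀ {x}, ContDiffAt ℝ 2 u x → ContDiffAt ℝ 2 v x → ∀ k,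
      coordDeriv k (fun x => u x + ε * v x) x = coordDeriv k u x + ε * coordDeriv k v x := by
    intro x h1 h2 k
    have h1' := h1.differentiableAt (by norm_num)
    have h2' := h2.differentiableAt (by norm_num)
    simp only [coordDeriv]
    rw [fderiv_fun_add h1' (h2'.const_mul ε), fderiv_const_mul h2']
    simp
  have hdd : ∀ i j, coordDeriv i (coordDeriv j (fun x => u x + ε * v x)) y
      = coordDeriv i (coordDeriv j u) y + ε * coordDeriv i (coordDeriv j v) y := by
    intro i j
    have he : coordDeriv j (fun x => u x + ε * v x) =ᶠ[𝓝 y]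
        fun x => coordDeriv j u x + ε * coordDeriv j v x := by
      filter_upwards [hu.eventually (by simp), hv.eventually (by simp)] with x h1 h2
      exact hd h1 h2 j
    have h1' := (hu.coordDeriv (k := 2) (l := 1) (by norm_num) j).differentiableAt (by norm_num)
    have h2' := (hv.coordDeriv (k := 2) (l := 1) (by norm_num) j).differentiableAt (by norm_num)
    rw [coordDeriv, he.fderiv_eq, fderiv_fun_add h1' (h2'.const_mul ε), fderiv_const_mul h2']
    simp [coordDeriv]
  simp only [secondOrderOp, hd hu hv, hdd, mul_add, Finset.sum_add_distrib, Finset.mul_sum]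
  simp only [mul_left_comm ε]
  ring

lemma continuousAt_secondOrderOp (ha : ∀ i j, ContinuousAt (fun y => a y i j) z)
    (hb : ∀ k, ContinuousAt (fun y => b y k) z) (hu : ContDiffAt ℝ 2 u z) :
    ContinuousAt (secondOrderOp a b u) z := by
  have h1 : ∀ j, ContDiffAt ℝ 1 (coordDeriv j u) z := fun j =>
    hu.coordDeriv (k := 2) (l := 1) (by norm_num) j
  have h2 : ∀ i j, ContinuousAt (coordDeriv i (coordDeriv j u)) z := fun i j =>
    ((h1 j).coordDeriv (k := 1) (l := 0) (by norm_num) i).continuousAt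
  unfold secondOrderOp
  refine ContinuousAt.add ?_ ?_
  · exact tendsto_finsetSum _ fun i _ => tendsto_finsetSum _ fun j _ => (ha i j).mul (h2 i j)
  · exact tendsto_finsetSum _ fun k _ => (hb k).mul (h1 k).continuousAt

/-- A barrier at a point of a sphere: it vanishes at the point, is negative outside the sphere, and
is a strict subsolution. -/
lemma exists_barrier (hzw : z ≠ w) (ha : (a z).PosDef) :
    ∃ v : EuclideanSpace ℝ (Fin m) → ℝ, ContDiff ℝ ∞ v ∧ v z = 0 ∧ 0 < secondOrderOp a b v z ∧
      ∀ᶠ y in 𝓝 z, dist z w < dist y w → v y < 0 := by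
  -- The barrier is `s + K s²`, up to scaling the second-order truncation of Hopf's `exp (α s) - 1`.
  -- Where `s = 0`, the square adds `2K a(∇s, ∇s)` to the operator; as `∇s = -2 (z - w)` this is `8
  -- K Q` with `Q > 0`, which dominates for large `K`.
  set s : EuclideanSpace ℝ (Fin m) → ℝ := fun y => ‖z - w‖ ^ 2 - ‖y - w‖ ^ 2 with hs
  have hsmooth : ContDiff ℝ ∞ s := contDiff_const.sub ((contDiff_id.sub contDiff_const).norm_sq ℝ)
  have hsz : s z = 0 := by simp [hs]
  have hds : ∀ k, coordDeriv k s z = -2 * (z - w) k := by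
    intro k
    have h : HasFDerivAt s (0 - 2 • (innerSL ℝ (z - w)).comp
        (ContinuousLinearMap.id ℝ (EuclideanSpace ℝ (Fin m)))) z :=
      (hasFDerivAt_const _ _).sub (((hasFDerivAt_id z).sub_const w).norm_sq)
    rw [coordDeriv, h.fderiv]
    simp [EuclideanSpace.inner_single_right]
  have hd1 : ∀ K k x, coordDeriv k (fun y => s y + K * s y ^ 2) x
      = coordDeriv k s x + 2 * K * (s x * coordDeriv k s x) := by
    intro K k x
    have hx : HasFDerivAt s (fderiv ℝ s x) x :=
      (hsmooth.differentiable (by simp) x).hasFDerivAt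
    have h : HasFDerivAt (fun y => s y + K * s y ^ 2) _ x := hx.add ((hx.pow 2).const_mul K)
    rw [coordDeriv, h.fderiv]
    simp [coordDeriv]
    ring
  have hd2 : ∀ K i j, coordDeriv i (coordDeriv j (fun y => s y + K * s y ^ 2)) z
      = coordDeriv i (coordDeriv j s) z + 2 * K * (coordDeriv i s z * coordDeriv j s z) := by
    intro K i j
    have hx : HasFDerivAt s (fderiv ℝ s z) z :=
      (hsmooth.differentiable (by simp) z).hasFDerivAt
    have hj : HasFDerivAt (coordDeriv j s) (fderiv ℝ (coordDeriv j s) z) z :=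
      ((hsmooth.contDiffAt.coordDeriv (k := ⊤) (l := 1) (by simp) j).differentiableAt
        (by norm_num)).hasFDerivAt
    have h : HasFDerivAt (fun x => coordDeriv j s x + 2 * K * (s x * coordDeriv j s x)) _ z :=
      hj.add ((hx.mul hj).const_mul (2 * K))
    rw [coordDeriv, show coordDeriv j (fun y => s y + K * s y ^ 2) = _ from funext (hd1 K j),
      h.fderiv]
    simp [hsz, coordDeriv, mul_comm]
  have hop : ∀ K, secondOrderOp a b (fun y => s y + K * s y ^ 2) z
      = secondOrderOp a b s z + 8 * K * ∑ i, ∑ j, a z i j * ((z - w) i * (z - w) j) := by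
    intro K
    simp only [secondOrderOp, hd2, hd1, hsz, zero_mul, mul_zero, add_zero, mul_add,
      Finset.sum_add_distrib, Finset.mul_sum]
    rw [add_right_comm]
    congr 1
    refine Finset.sum_congr rfl fun i _ => Finset.sum_congr rfl fun j _ => ?_
    rw [hds, hds]
    ring
  have hQ : 0 < ∑ i, ∑ j, a z i j * ((z - w) i * (z - w) j) := by
    have hne : (z - w).ofLp ≠ 0 := fun h => hzw (sub_eq_zero.mp (by ext i; simpa using congrFun h i))
    have := ha.dotProduct_mulVec_pos hne
    simp only [dotProduct, Matrix.mulVec, Finset.mul_sum, Pi.star_apply, star_trivial] at this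
    refine this.trans_eq (Finset.sum_congr rfl fun i _ => Finset.sum_congr rfl fun j _ => ?_)
    ring
  set Q := ∑ i, ∑ j, a z i j * ((z - w) i * (z - w) j)
  obtain ⟨K, hK0, hK⟩ : ∃ K : ℝ, 0 < K ∧ 0 < secondOrderOp a b s z + 8 * K * Q := by
    refine ⟨(|secondOrderOp a b s z| + 1) / Q, by positivity, ?_⟩
    have : 8 * ((|secondOrderOp a b s z| + 1) / Q) * Q = 8 * (|secondOrderOp a b s z| + 1) := by
      field_simp
    rw [this]
    linarith [neg_abs_le (secondOrderOp a b s z), abs_nonneg (secondOrderOp a b s z)]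
  refine ⟨fun y => s y + K * s y ^ 2, hsmooth.add (contDiff_const.mul (hsmooth.pow 2)), by simp [hsz],
    (hop K).symm ▸ hK, ?_⟩
  -- The barrier factors as `s (1 + K s)`, so near `z` it has the sign of `s`.
  have hev : ∀ᶠ y in 𝓝 z, 0 < 1 + K * s y := by
    have hc : ContinuousAt (fun y => 1 + K * s y) z :=
      continuousAt_const.add (continuousAt_const.mul hsmooth.continuous.continuousAt)
    exact hc.eventually (lt_mem_nhds (by simp [hsz]))
  filter_upwards [hev] with y hy hlt
  have hneg : s y < 0 := by
    rw [dist_eq_norm, dist_eq_norm] at hlt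
    have := pow_lt_pow_left₀ hlt (norm_nonneg _) two_ne_zero
    simp only [hs]
    linarith
  nlinarith

/-- Hopf's argument: a subsolution cannot touch its maximum at a point of a sphere inside which it
is strictly smaller. -/
lemma false_of_touching_sphere (hzw : z ≠ w) (hpos : (a z).PosDef)
    (hpos' : ∀ᶠ y in 𝓝 z, (a y).PosSemidef)
    (ha : ∀ i j, ContinuousAt (fun y => a y i j) z) (hb : ∀ k, ContinuousAt (fun y => b y k) z)
    (hu : ContDiffAt ℝ 2 u z) (hLu : ∀ᶠ y in 𝓝 z, 0 ≤ secondOrderOp a b u y)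
    (hmax : ∀ᶠ y in 𝓝 z, u y ≤ u z)
    (hlt : ∀ᶠ y in 𝓝 z, y ≠ z → dist y w ≤ dist z w → u y < u z) : False := by
  obtain ⟨v, hv, hvz, hLv, hvneg⟩ := exists_barrier (b := b) hzw hpos
  have hv2 : ∀ y, ContDiffAt ℝ 2 v y := fun y => (contDiff_infty.mp hv 2).contDiffAt
  have hLv' : ∀ᶠ y in 𝓝 z, 0 < secondOrderOp a b v y :=
    (continuousAt_secondOrderOp ha hb (hv2 z)).eventually (lt_mem_nhds hLv)
  obtain ⟨δ, hδ, hball⟩ := nhds_basis_closedBall.eventually_iff.mp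
    (hpos'.and ((hu.eventually (by simp)).and (hLu.and (hmax.and (hlt.and (hvneg.and hLv'))))))
  -- On `S` the strict gap, uniform by compactness, absorbs `ε v`; on the rest of the small sphere
  -- `v < 0` and `u ≤ u z`. So `u + ε v`, equal to `u z` at `z`, has an interior maximum, although
  -- the operator is positive on it.
  set S := sphere z δ ∩ closedBall w (dist z w) with hSdef
  have hScomp : IsCompact S := (isCompact_sphere z δ).inter_right isClosed_closedBall
  have hucont : ContinuousOn u (closedBall z δ) := fun y hy =>
    (hball hy).2.1.continuousAt.continuousWithinAt
  have hS : ∀ y ∈ S, u y < u z := fun y hy =>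
    (hball (sphere_subset_closedBall hy.1)).2.2.2.2.1
      (ne_of_mem_sphere hy.1 hδ.ne') hy.2
  obtain ⟨ε, hε, hεS⟩ : ∃ ε > 0, ∀ y ∈ S, u y + ε * v y < u z := by
    rcases S.eq_empty_or_nonempty with hSe | hSne
    · exact ⟨1, one_pos, by simp [hSe]⟩
    obtain ⟨x₁, hx₁, hx₁max⟩ := hScomp.exists_isMaxOn hSne
      (hucont.mono (Set.inter_subset_left.trans sphere_subset_closedBall))
    obtain ⟨x₂, hx₂, hx₂max⟩ := hScomp.exists_isMaxOn hSne hv.continuous.continuousOn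
    have hgap := sub_pos.mpr (hS x₁ hx₁)
    refine ⟨(u z - u x₁) / (|v x₂| + 1), by positivity, fun y hy => ?_⟩
    have h1 : u y ≤ u x₁ := hx₁max hy
    have h2 : v y ≤ |v x₂| := (show v y ≤ v x₂ from hx₂max hy).trans (le_abs_self _)
    have h3 : (u z - u x₁) / (|v x₂| + 1) * v y < u z - u x₁ := by
      rw [div_mul_eq_mul_div, div_lt_iff₀ (by positivity)]
      exact mul_lt_mul_of_pos_left (by linarith) hgap
    linarith
  obtain ⟨x, hx, hxmax⟩ := (isCompact_closedBall z δ).exists_isMaxOn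
    ⟨z, mem_closedBall_self hδ.le⟩
    (hucont.add (continuousOn_const.mul hv.continuous.continuousOn) :
      ContinuousOn (fun y => u y + ε * v y) (closedBall z δ))
  have hxz : u z ≤ u x + ε * v x := by
    have : u z + ε * v z ≤ u x + ε * v x := hxmax (mem_closedBall_self hδ.le)
    simpa [hvz] using this
  have hxball : x ∈ ball z δ := by
    by_contra hnot
    have hsph : x ∈ sphere z δ :=
      le_antisymm (mem_closedBall.mp hx) (not_lt.mp hnot)
    by_cases hxw : dist x w ≤ dist z w
    · exact absurd (hεS x ⟨hsph, hxw⟩) (not_lt.mpr hxz)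
    · have h1 := (hball hx).2.2.2.2.2.1 (not_le.mp hxw)
      have h2 := (hball hx).2.2.2.1
      nlinarith
  have hloc : IsLocalMax (fun y => u y + ε * v y) x :=
    hxmax.isLocalMax (mem_of_superset (isOpen_ball.mem_nhds hxball) ball_subset_closedBall)
  obtain ⟨hxa, hxu, hxLu, -, -, -, hxLv⟩ := hball hx
  have := hloc.secondOrderOp_nonpos (a := a) (b := b)
    (hxu.add (contDiffAt_const.mul (hv2 x))) hxa
  rw [secondOrderOp_add_const_mul hxu (hv2 x)] at this
  nlinarith

/-- **Hopf's strong maximum principle**: a subsolution of an elliptic equation is constant near a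
local maximum. -/
theorem IsLocalMax.eventually_eq_of_secondOrderOp_nonneg {U : Set (EuclideanSpace ℝ (Fin m))}
    (hU : IsOpen U) (hy : y ∈ U) (hpos : ∀ x ∈ U, (a x).PosDef)
    (ha : ∀ i j, ContinuousOn (fun y => a y i j) U) (hb : ∀ k, ContinuousOn (fun y => b y k) U)
    (hu : ContDiffOn ℝ 2 u U) (hLu : ∀ x ∈ U, 0 ≤ secondOrderOp a b u x)
    (hmax : IsLocalMax u y) : ∀ᶠ x in 𝓝 y, u x = u y := by
  obtain ⟨r, hr, hball⟩ := nhds_basis_ball.eventually_iff.mp ((hU.eventually_mem hy).and hmax)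
  -- With `y₁` within `ρ` of `y`, the ball about `y₁` of radius at most `dist y y₁` stays within
  -- `2ρ` of `y`, leaving room inside the ball of radius `3ρ`.
  obtain ⟨ρ, hρ, rfl⟩ : ∃ ρ > 0, 3 * ρ = r := ⟨r / 3, by positivity, by ring⟩
  refine nhds_basis_ball.eventually_iff.mpr ⟨ρ, hρ, fun y₁ hy₁ => ?_⟩
  by_contra hne
  have hsub : closedBall y (2 * ρ) ⊆ ball y (3 * ρ) := closedBall_subset_ball (by linarith)
  have hucont : ContinuousOn u (closedBall y (2 * ρ)) :=
    hu.continuousOn.mono fun x hx => (hball (hsub hx)).1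
  set F := closedBall y (2 * ρ) ∩ u ⁻¹' {u y}
  have hFcomp : IsCompact F := (isCompact_closedBall y (2 * ρ)).of_isClosed_subset
    (hucont.preimage_isClosed_of_isClosed isClosed_closedBall isClosed_singleton)
    Set.inter_subset_left
  have hyF : y ∈ F := ⟨mem_closedBall_self (by positivity), rfl⟩
  -- At the point of the level set nearest to `y₁`, an open ball where `u < u y` touches that set.
  obtain ⟨z, hzF, hzmin⟩ := hFcomp.exists_isMinOn ⟨y, hyF⟩
    (f := fun x => dist x y₁) (by fun_prop)
  have hz_le : dist z y₁ ≤ dist y y₁ := hzmin hyF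
  rw [mem_ball, dist_comm] at hy₁
  have hzball : z ∈ ball y (2 * ρ) := by
    rw [mem_ball]
    linarith [dist_triangle z y₁ y, dist_comm y y₁]
  have hin : ∀ x, dist x y₁ < dist z y₁ → u x < u y := by
    intro x hx
    have hx2 : x ∈ closedBall y (2 * ρ) := by
      rw [mem_closedBall]
      linarith [dist_triangle x y₁ y, dist_comm y y₁]
    refine lt_of_le_of_ne (hball (hsub hx2)).2 fun heq => ?_
    exact absurd (show dist z y₁ ≤ dist x y₁ from hzmin ⟨hx2, heq⟩) (not_le.mpr hx)
  have hzy₁ : z ≠ y₁ := fun h => hne (h ▸ hzF.2)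
  have huz : u z = u y := hzF.2
  have hzU : z ∈ U := (hball (hsub hzF.1)).1
  have hUz := hU.mem_nhds hzU
  -- The ball of half the radius, centred at the midpoint, is internally tangent at `z`, so its
  -- closure meets the larger sphere only there.
  refine false_of_touching_sphere (a := a) (b := b) (u := u) (z := z) (w := midpoint ℝ y₁ z)
    ?_ (hpos z hzU)
    (by filter_upwards [hUz] with x hx using (hpos x hx).posSemidef)
    (fun i j => (ha i j).continuousAt hUz) (fun k => (hb k).continuousAt hUz)
    (hu.contDiffAt hUz) (by filter_upwards [hUz] with x hx using hLu x hx) ?_ ?_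
  · exact fun h => hzy₁ (midpoint_eq_right_iff ℝ |>.mp h.symm).symm
  · filter_upwards [isOpen_ball.mem_nhds hzball] with x hx
    rw [huz]
    exact (hball (hsub (ball_subset_closedBall hx))).2
  · refine Eventually.of_forall fun x hxz hxw => ?_
    rw [huz]
    refine hin x ?_
    set w := midpoint ℝ y₁ z with hw
    have hsum : y₁ + z = (2 : ℝ) • w := by
      rw [hw, midpoint_eq_smul_add, smul_smul]; norm_num
    -- This gives `‖x - y₁‖² + ‖x - z‖² = 2‖x - w‖² + 2‖z - w‖² ≤ ‖z - y₁‖²`, strict for `‖x - y₁‖`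
    -- once `x ≠ z`.
    have hpar := parallelogram_law_with_norm ℝ (x - w) (z - w)
    have e1 : x - w + (z - w) = x - y₁ := by
      have : y₁ = (2 : ℝ) • w - z := eq_sub_of_add_eq hsum
      rw [this, two_smul]; abel
    have e2 : z - y₁ = (2 : ℝ) • (z - w) := by
      have : y₁ = (2 : ℝ) • w - z := eq_sub_of_add_eq hsum
      rw [this, smul_sub, two_smul, two_smul]; abel
    rw [dist_eq_norm, dist_eq_norm] at hxw ⊢
    rw [e1, sub_sub_sub_cancel_right] at hpar
    rw [e2, norm_smul, Real.norm_ofNat]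
    have h3 : 0 < ‖x - z‖ := norm_pos_iff.mpr (sub_ne_zero.mpr hxz)
    nlinarith [norm_nonneg (x - w), norm_nonneg (z - w), norm_nonneg (x - y₁)]

end EllipticMaximumPrinciple

/-! ### The harmonic map equation in a chart: ellipticity and continuity of its coefficients. -/

section RiemannianChart

variable {m n : ℕ} {M : Type*} [TopologicalSpace M] [ChartedSpace (EuclideanSpace ℝ (Fin m)) M]
  {e : OpenPartialHomeomorph M (EuclideanSpace ℝ (Fin m))}
  {y : EuclideanSpace ℝ (Fin m)}

/-- The components of a harmonic map satisfy an elliptic equation in each chart. -/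
lemma IsHarmonicMap.secondOrderOp_eq_zero
    [Bundle.RiemannianBundle (fun x : M => TangentSpace (𝓡 m) x)] {f : M → EuclideanSpace ℝ (Fin n)}
    (hf : IsHarmonicMap (m := m) f) (ν : EuclideanSpace ℝ (Fin n))
    (he : e ∈ IsManifold.maximalAtlas (𝓡 m) ∞ M) (hy : y ∈ e.target) :
    secondOrderOp (fun y => (metricMatrix e y)⁻¹)
      (fun y k => -∑ i, ∑ j, (metricMatrix e y)⁻¹ i j * christoffel e k i j y)
      (fun y => inner ℝ ν (f (e.symm y))) y = 0 := by
  have hsmooth : ContDiffOn ℝ ∞ (f ∘ e.symm) e.target :=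
    (hf.1.comp_contMDiffOn (contMDiffOn_symm_of_mem_maximalAtlas he)).contDiffOn
  have hat : ∀ x ∈ e.target, ContDiffAt ℝ ∞ (f ∘ e.symm) x := fun x hx =>
    hsmooth.contDiffAt (e.open_target.mem_nhds hx)
  have hfd : ∀ {h : EuclideanSpace ℝ (Fin m) → EuclideanSpace ℝ (Fin n)} {x} (k : Fin m),
      DifferentiableAt ℝ h x →
      coordDeriv k (fun z => inner ℝ ν (h z)) x = inner ℝ ν (coordDeriv k h x) := by
    intro h x k hx
    have := (innerSL ℝ ν).hasFDerivAt.comp x hx.hasFDerivAt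
    exact congrArg (fun L => L (EuclideanSpace.single k 1)) this.fderiv
  have h1 : ∀ k, ∀ x ∈ e.target, coordDeriv k (fun z => inner ℝ ν (f (e.symm z))) x
      = inner ℝ ν (coordDeriv k (f ∘ e.symm) x) := fun k x hx =>
    hfd (h := f ∘ e.symm) k ((hat x hx).differentiableAt (by simp))
  have h2 : ∀ i j, coordDeriv i (coordDeriv j (fun z => inner ℝ ν (f (e.symm z)))) y
      = inner ℝ ν (coordDeriv i (coordDeriv j (f ∘ e.symm)) y) := by
    intro i j
    have hev : coordDeriv j (fun z => inner ℝ ν (f (e.symm z))) =ᶠ[𝓝 y]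
        fun z => inner ℝ ν (coordDeriv j (f ∘ e.symm) z) := by
      filter_upwards [e.open_target.mem_nhds hy] with x hx using h1 j x hx
    rw [coordDeriv, hev.fderiv_eq]
    exact hfd i (((hat y hy).coordDeriv (k := ⊤) (l := 1) (by simp) j).differentiableAt
      (by norm_num))
  -- Pairing with the fixed vector `ν` commutes with coordinate derivatives, so the scalar equation
  -- is the `ν`-component of the vanishing tension field.
  have h0 : inner ℝ ν (tensionField e f y) = 0 := by rw [hf.2 e he y hy, inner_zero_right]
  rw [← h0]
  simp only [secondOrderOp, tensionField, secondFundamentalForm, h2, h1 _ y hy, inner_sum,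
    inner_smul_right, inner_sub_right, mul_sub, Finset.sum_sub_distrib, neg_mul,
    Finset.sum_neg_distrib, Finset.mul_sum, Finset.sum_mul, mul_assoc, ← sub_eq_add_neg]
  congr 1
  rw [Finset.sum_comm]
  exact Finset.sum_congr rfl fun i _ => Finset.sum_comm

/-- The inverse chart has injective derivative. This makes the Gram matrix `metricMatrix` positive
definite, hence the equation elliptic. -/
lemma linearIndependent_coordVector (he : e ∈ IsManifold.maximalAtlas (𝓡 m) ∞ M)
    (hy : y ∈ e.target) : LinearIndependent ℝ fun i => coordVector e i y := by
  have hmd : e.MDifferentiable (𝓡 m) (𝓡 m) :=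
    ⟨(contMDiffOn_of_mem_maximalAtlas he).mdifferentiableOn (by simp),
      (contMDiffOn_symm_of_mem_maximalAtlas he).mdifferentiableOn (by simp)⟩
  have hli : LinearIndependent ℝ fun i : Fin m => EuclideanSpace.single i (1 : ℝ) := by
    have h := (EuclideanSpace.basisFun (Fin m) ℝ).orthonormal.linearIndependent
    rwa [show ⇑(EuclideanSpace.basisFun (Fin m) ℝ) = fun i => EuclideanSpace.single i 1 from
      funext (EuclideanSpace.basisFun_apply _ _)] at h
  exact hli.map' (mfderiv (𝓡 m) (𝓡 m) e.symm y).toLinearMap (hmd.symm.ker_mfderiv_eq_bot hy)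

variable [IsManifold (𝓡 m) ∞ M]

/-- The coordinate field is the tangent map of the inverse chart applied to a constant section;
smoothness of the metric coefficients follows. -/
lemma contMDiffOn_coordVector (he : e ∈ IsManifold.maximalAtlas (𝓡 m) ∞ M) (i : Fin m) :
    ContMDiffOn (𝓡 m) (𝓡 m).tangent ∞
      (fun y => (⟨e.symm y, coordVector e i y⟩ : TangentBundle (𝓡 m) M)) e.target := by
  have h1 := (contMDiffOn_symm_of_mem_maximalAtlas he).contMDiffOn_tangentMapWithin
    (m := ∞) (by simp) e.open_target.uniqueMDiffOn
  have h2 : ContMDiffOn (𝓡 m) (𝓡 m).tangent ∞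
      (fun y => (⟨y, EuclideanSpace.single i (1 : ℝ)⟩ :
        TangentBundle (𝓡 m) (EuclideanSpace ℝ (Fin m)))) e.target :=
    contMDiffOn_vectorSpace_iff_contDiffOn.mpr contDiffOn_const
  refine (h1.comp h2 fun y hy => hy).congr fun y hy => ?_
  simp [tangentMapWithin, coordVector, mfderivWithin_of_isOpen e.open_target hy]

variable [Bundle.RiemannianBundle (fun x : M => TangentSpace (𝓡 m) x)]

lemma posDef_metricMatrix (he : e ∈ IsManifold.maximalAtlas (𝓡 m) ∞ M) (hy : y ∈ e.target) :
    (metricMatrix e y).PosDef :=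
  Matrix.posDef_gram_of_linearIndependent (linearIndependent_coordVector he hy)

variable [IsContMDiffRiemannianBundle (𝓡 m) ∞ (EuclideanSpace ℝ (Fin m))
      (fun x : M => TangentSpace (𝓡 m) x)]

lemma contDiffOn_metricMatrix (he : e ∈ IsManifold.maximalAtlas (𝓡 m) ∞ M) (i j : Fin m) :
    ContDiffOn ℝ ∞ (fun y => metricMatrix e y i j) e.target := by
  rw [← contMDiffOn_iff_contDiffOn]
  exact (contMDiffOn_coordVector he i).inner_bundle (contMDiffOn_coordVector he j)

lemma continuousOn_inv_metricMatrix (he : e ∈ IsManifold.maximalAtlas (𝓡 m) ∞ M) (i j : Fin m) :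
    ContinuousOn (fun y => (metricMatrix e y)⁻¹ i j) e.target := by
  intro y hy
  have hg : ContinuousWithinAt (metricMatrix e) e.target y :=
    continuousWithinAt_pi.mpr fun i => continuousWithinAt_pi.mpr fun j =>
      (contDiffOn_metricMatrix he i j).continuousOn y hy
  have hdet : (metricMatrix e y).det ≠ 0 := (posDef_metricMatrix he hy).det_pos.ne'
  -- Cramer's rule: the inverse is the adjugate divided by the nonvanishing determinant.
  have hinv : ContinuousWithinAt (fun y => (metricMatrix e y)⁻¹) e.target y := by
    simp only [Matrix.inv_def, Ring.inverse_eq_inv']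
    exact ((Continuous.matrix_det continuous_id).continuousAt.comp_continuousWithinAt hg |>.inv₀
      hdet).smul ((Continuous.matrix_adjugate continuous_id).continuousAt.comp_continuousWithinAt hg)
  exact continuousWithinAt_pi.mp (continuousWithinAt_pi.mp hinv i) j

lemma continuousOn_coordDeriv_metricMatrix (he : e ∈ IsManifold.maximalAtlas (𝓡 m) ∞ M)
    (i j k : Fin m) :
    ContinuousOn (coordDeriv k fun y => metricMatrix e y i j) e.target := fun y hy =>
  (((contDiffOn_metricMatrix he i j).contDiffAt (e.open_target.mem_nhds hy)).coordDeriv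
    (k := ⊤) (l := 0) (by simp) k).continuousAt.continuousWithinAt

lemma continuousOn_christoffel (he : e ∈ IsManifold.maximalAtlas (𝓡 m) ∞ M) (k i j : Fin m) :
    ContinuousOn (christoffel e k i j) e.target := by
  refine continuousOn_const.mul (continuousOn_finsetSum _ fun l _ =>
    (continuousOn_inv_metricMatrix he k l).mul ?_)
  exact ((continuousOn_coordDeriv_metricMatrix he j l i).add
    (continuousOn_coordDeriv_metricMatrix he i l j)).sub
    (continuousOn_coordDeriv_metricMatrix he i j l)


/-- The strong maximum principle for the components of a harmonic map. -/
theorem IsHarmonicMap.eventually_inner_eq {f : M → EuclideanSpace ℝ (Fin n)}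
    (hf : IsHarmonicMap (m := m) f) (ν : EuclideanSpace ℝ (Fin n)) {x : M}
    (hmax : IsLocalMax (fun p => (inner ℝ ν (f p) : ℝ)) x) :
    ∀ᶠ p in 𝓝 x, (inner ℝ ν (f p) : ℝ) = inner ℝ ν (f x) := by
  set e := chartAt (EuclideanSpace ℝ (Fin m)) x
  have he : e ∈ IsManifold.maximalAtlas (𝓡 m) ∞ M := IsManifold.chart_mem_maximalAtlas x
  have hx : x ∈ e.source := mem_chart_source _ x
  have hy : e x ∈ e.target := e.map_source hx
  have hsmooth : ContDiffOn ℝ ∞ (f ∘ e.symm) e.target :=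
    (hf.1.comp_contMDiffOn (contMDiffOn_symm_of_mem_maximalAtlas he)).contDiffOn
  have hu : ContDiffOn ℝ ∞ (fun y => (inner ℝ ν (f (e.symm y)) : ℝ)) e.target :=
    contDiffOn_const.inner ℝ hsmooth
  have hsymm : Tendsto e.symm (𝓝 (e x)) (𝓝 x) := by
    simpa [e.left_inv hx] using (e.continuousAt_symm hy).tendsto
  have hmax' : IsLocalMax (fun y => (inner ℝ ν (f (e.symm y)) : ℝ)) (e x) := by
    filter_upwards [hsymm.eventually hmax] with y h
    simpa [e.left_inv hx] using h
  have hconst := hmax'.eventually_eq_of_secondOrderOp_nonneg e.open_target hy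
    (a := fun y => (metricMatrix e y)⁻¹)
    (b := fun y k => -∑ i, ∑ j, (metricMatrix e y)⁻¹ i j * christoffel e k i j y)
    (fun z hz => (posDef_metricMatrix he hz).inv) (continuousOn_inv_metricMatrix he)
    (fun k => (continuousOn_finsetSum _ fun i _ => continuousOn_finsetSum _ fun j _ =>
      (continuousOn_inv_metricMatrix he i j).mul (continuousOn_christoffel he k i j)).neg)
    (contDiffOn_infty.mp hu 2) (fun z hz => (hf.secondOrderOp_eq_zero ν he hz).ge)
  filter_upwards [(e.continuousAt hx).eventually hconst, e.open_source.mem_nhds hx] with p hp hps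
  simpa [e.left_inv hps, e.left_inv hx] using hp

end RiemannianChart

/-- A point of `F` in the closure of a connected component of `F` belongs to that component. -/
lemma mem_connectedComponentIn_of_mem_closure {X : Type*} [TopologicalSpace X] {F : Set X}
    {x y : X} (hx : x ∈ F) (hy : y ∈ F) (hcl : y ∈ closure (connectedComponentIn F x)) :
    y ∈ connectedComponentIn F x := by
  -- Adding a closure point keeps the component preconnected, so maximality absorbs it.
  have hpre : IsPreconnected (insert y (connectedComponentIn F x)) :=
    isPreconnected_connectedComponentIn.subset_closure (Set.subset_insert _ _)
      (Set.insert_subset hcl subset_closure)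
  exact hpre.subset_connectedComponentIn (Set.mem_insert_of_mem _ (mem_connectedComponentIn hx))
    (Set.insert_subset hy (connectedComponentIn_subset F x)) (Set.mem_insert _ _)

/-! ### Global consequences on a connected manifold. -/

section HarmonicMap

variable {m n : ℕ} {M : Type*} [TopologicalSpace M] [ChartedSpace (EuclideanSpace ℝ (Fin m)) M]
  [IsManifold (𝓡 m) ∞ M] [Bundle.RiemannianBundle (fun x : M => TangentSpace (𝓡 m) x)]
  [IsContMDiffRiemannianBundle (𝓡 m) ∞ (EuclideanSpace ℝ (Fin m))
    (fun x : M => TangentSpace (𝓡 m) x)] [ConnectedSpace M]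
  {f : M → EuclideanSpace ℝ (Fin n)}

/-- If a component of a harmonic map attains its maximum over the closed set `K` at `x`, and each
point of `K` where this maximum is attained is interior to `K`, then `K` is the whole manifold and
the component is constant. -/
lemma IsHarmonicMap.inner_eq_of_isMaxOn (hf : IsHarmonicMap (m := m) f)
    (ν : EuclideanSpace ℝ (Fin n)) {K : Set M} (hK : IsClosed K) {x : M} (hx : x ∈ K)
    (hmax : ∀ p ∈ K, (inner ℝ ν (f p) : ℝ) ≤ inner ℝ ν (f x))
    (hint : ∀ p ∈ K, (inner ℝ ν (f p) : ℝ) = inner ℝ ν (f x) → K ∈ 𝓝 p) (p : M) :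
    p ∈ K ∧ (inner ℝ ν (f p) : ℝ) = inner ℝ ν (f x) := by
  have hcont : Continuous fun p => (inner ℝ ν (f p) : ℝ) :=
    continuous_const.inner hf.1.continuous
  have hclopen : IsClopen {p | p ∈ K ∧ (inner ℝ ν (f p) : ℝ) = inner ℝ ν (f x)} := by
    refine ⟨hK.inter (isClosed_eq hcont continuous_const), isOpen_iff_mem_nhds.mpr ?_⟩
    rintro q ⟨hqK, hq⟩
    have hloc : IsLocalMax (fun p => (inner ℝ ν (f p) : ℝ)) q := by
      filter_upwards [hint q hqK hq] with p hp
      rw [hq]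
      exact hmax p hp
    filter_upwards [hint q hqK hq, hf.eventually_inner_eq ν hloc] with p hpK hp
    exact ⟨hpK, hp.trans hq⟩
  exact Set.eq_univ_iff_forall.mp (hclopen.eq_univ ⟨x, hx, rfl⟩) p

/-- A harmonic map from a compact connected manifold to a Euclidean space is constant. -/
lemma IsHarmonicMap.eq_of_compactSpace [CompactSpace M] (hf : IsHarmonicMap (m := m) f)
    (p q : M) : f p = f q := by
  have key : ∀ ν : EuclideanSpace ℝ (Fin n), (inner ℝ ν (f p) : ℝ) = inner ℝ ν (f q) := by
    intro ν
    obtain ⟨x, -, hx⟩ := isCompact_univ.exists_isMaxOn ⟨p, Set.mem_univ p⟩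
      (continuous_const.inner hf.1.continuous :
        Continuous fun p => (inner ℝ ν (f p) : ℝ)).continuousOn
    have h := hf.inner_eq_of_isMaxOn ν isClosed_univ (Set.mem_univ x) hx
      fun _ _ _ => univ_mem
    exact (h p).2.trans (h q).2.symm
  exact ext_inner_left ℝ key

/-- A connected manifold carrying a proper harmonic map into an open set with the enclosing
property is compact. -/
lemma IsHarmonicMap.compactSpace_of_hasEnclosingProperty {R : Set (EuclideanSpace ℝ (Fin n))}
    (hf : IsHarmonicMap (m := m) f) (hR : IsOpen R) (hRenc : HasEnclosingProperty R)
    (hproper : IsProperMap f) (hfR : ∀ x, f x ∈ R) : CompactSpace M := by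
  obtain ⟨x₀⟩ := (inferInstance : Nonempty M)
  obtain ⟨H, ⟨ν₀, c₀, -, rfl⟩, hpH, hcomp⟩ := hRenc (f x₀) (hfR x₀)
  -- Negating the equation if necessary puts `f x₀` on the upper side, so that the maximum lies off
  -- the hyperplane.
  obtain ⟨ν, c, hH, hpos⟩ : ∃ (ν : EuclideanSpace ℝ (Fin n)) (c : ℝ),
      {x | (inner ℝ ν₀ x : ℝ) = c₀} = {x | (inner ℝ ν x : ℝ) = c} ∧ c < inner ℝ ν (f x₀) := by
    rcases lt_or_gt_of_ne (show (inner ℝ ν₀ (f x₀) : ℝ) ≠ c₀ from hpH) with h | h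
    · exact ⟨-ν₀, -c₀, by simp [inner_neg_left], by simpa [inner_neg_left] using h⟩
    · exact ⟨ν₀, c₀, rfl, h⟩
  rw [hH] at hpH hcomp
  set W := R \ {x | (inner ℝ ν x : ℝ) = c}
  set B := connectedComponentIn W (f x₀)
  have hW : IsOpen W :=
    hR.sdiff (isClosed_eq (continuous_const.inner continuous_id) continuous_const)
  have hx₀W : f x₀ ∈ W := ⟨hfR x₀, hpH⟩
  have hcont := hf.1.continuous
  have hKcomp : IsCompact (f ⁻¹' closure B) := hproper.isCompact_preimage hcomp
  have hx₀K : x₀ ∈ f ⁻¹' closure B := subset_closure (mem_connectedComponentIn hx₀W)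
  obtain ⟨x, hxK, hx⟩ := hKcomp.exists_isMaxOn ⟨x₀, hx₀K⟩
    (continuous_const.inner hcont : Continuous fun p => (inner ℝ ν (f p) : ℝ)).continuousOn
  have hcx : c < inner ℝ ν (f x) := hpos.trans_le (hx hx₀K)
  have hint : ∀ p ∈ f ⁻¹' closure B, (inner ℝ ν (f p) : ℝ) = inner ℝ ν (f x) →
      f ⁻¹' closure B ∈ 𝓝 p := by
    intro p hpK hp
    -- The value lies in `R` and its height exceeds `c`, so it lies in `W`; a point of `W` in
    -- `closure B` lies in `B`.
    have hpB : f p ∈ B := mem_connectedComponentIn_of_mem_closure hx₀W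
      ⟨hfR p, fun h => hcx.ne' (hp.symm.trans h)⟩ hpK
    exact mem_of_superset ((hW.connectedComponentIn.preimage hcont).mem_nhds hpB)
      (Set.preimage_mono subset_closure)
  have hall := hf.inner_eq_of_isMaxOn ν (isClosed_closure.preimage hcont) hxK (fun p hp => hx hp)
    hint
  exact ⟨hKcomp.of_isClosed_subset isClosed_univ fun p _ => (hall p).1⟩

end HarmonicMap

end
theorem theorem3p4 {m n : ℕ} {M : Type*} [MetricSpace M]
    [ChartedSpace (EuclideanSpace ℝ (Fin m)) M] [IsManifold (𝓡 m) ∞ M]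
    [Bundle.RiemannianBundle (fun x : M => TangentSpace (𝓡 m) x)]
    [IsContMDiffRiemannianBundle (𝓡 m) ∞ (EuclideanSpace ℝ (Fin m))
      (fun x : M => TangentSpace (𝓡 m) x)]
    [IsRiemannianManifold (𝓡 m) M] [CompleteSpace M] [ConnectedSpace M]
    (C R : Set (EuclideanSpace ℝ (Fin n))) (hC : IsPerturbedCone C) (hR : IsConeRegion C R)
    (f : M → EuclideanSpace ℝ (Fin n)) (hf : IsHarmonicMap (m := m) f) (hproper : IsProperMap f)
    (hfR : ∀ x, f x ∈ R) :
    ∃ c : EuclideanSpace ℝ (Fin n), ∀ x, f x = c := by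
  have hRopen : IsOpen R := by
    obtain ⟨x, -, rfl⟩ := hR.1
    exact hC.isClosed.isOpen_compl.connectedComponentIn
  have := hf.compactSpace_of_hasEnclosingProperty hRopen hR.2 hproper hfR
  obtain ⟨x₀⟩ := (inferInstance : Nonempty M)
  exact ⟨f x₀, fun x => hf.eq_of_compactSpace x x₀⟩
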